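/- For natural numbers $m,n\ge 1$, call a triple $(x,y,z)$ of positive integers with $$\frac mn=\frac1x+\frac1y+\frac1z$$ a Type II solution if $n$ divides both $y$ and $z$ and $n$ is coprime to $x$. For every natural number $m\ge 6$ there exists a prime $p>m^2$ for which the equation $\frac mp=\frac1x+\frac1y+\frac1z$ has no Type II solution. Moreover, for every natural number $m\ge 6$ with $m\ne 7$ such a prime exists in the interval $(m^2,2m^2]$. -/

import Mathlib

/-- `(x, y, z)` is a solution of `m / n = 1 / x + 1 / y + 1 / z` in positive integers. -/
def IsUnitFractionSolution (m n x y z : ℕ) : Prop :=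
  0 < x ∧ 0 < y ∧ 0 < z ∧
    (m : ℚ) / (n : ℚ) = 1 / (x : ℚ) + 1 / (y : ℚ) + 1 / (z : ℚ)

/-- A Type II solution: a solution in which `n` divides `y` and `z` but is coprime to `x`. -/
def IsTypeIISolution (m n x y z : ℕ) : Prop :=
  IsUnitFractionSolution m n x y z ∧ n ∣ y ∧ n ∣ z ∧ Nat.Coprime n x

/-!
A Type II solution for a prime `p` amounts to a representation `m * (a * b * d) = p + e` with
`e ∣ a + b` (`IsTypeIISolution.exists_param`). Here `e ≤ a + b ≤ a * b + 1`, so for `p` of size about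
`m ^ 2` the cofactor `n = a * b * d` has size about `m`, and `p` is determined by `n` and `e`.

For large `m` there are too few such pairs. When `m ^ 2 < p ≤ 2 * m ^ 2`, the number of pairs
`(n, e)` is `O(m ^ (3 / 2))` (`card_typeII_le`): the small `e` are counted trivially, and for the
large ones the quotient `f = (a + b) / e` is small, so that counting `e` for given `a`, `d`, `f`
costs a factor `m / (a * d * f)`, and the sum of these is `m` times the cube of a harmonic sum. The
analysis of the central binomial coefficient behind Bertrand's postulate gives at least a constant
times `m ^ 2 / log m` primes in `(m ^ 2, 2 * m ^ 2]` (`mul_log_four_div_three_lt`). The second number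
exceeds the first for `m ≥ 65536 = 4 ^ 8` (`exists_prime_of_large`).

For `41 ≤ m < 65536` a sufficient condition is used. If `p = m * n - r` with `n / 2 + 2 < r < m ≤ n`,
then necessarily `e = r` and `a * b * d = n`, which is impossible because no sum `a + b` with
`a * b ∣ n` is a multiple of `r` (`not_isTypeIISolution_of_residue`). Since
`m * n = c ^ 2 - (c - m) ^ 2` when `m + n = 2 * c`, a single prime a little below `c ^ 2` satisfies
this for all `m` in a whole interval below `c` (`not_isTypeIISolution_of_near_square`). About three
thousand such primes cover the range; the kernel finds them, recognizing a prime by its being coprime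
to the product of all smaller candidates for its least prime factor (`exists_prime_of_searchBlocks`).
The remaining values of `m` are checked directly from the parametrization.
-/

/-! ### Parametrization of Type II solutions -/

/-- Every Type II solution for a prime `p` comes from natural numbers `a`, `b`, `d`, `e` with
`m * (a * b * d) = p + e` and `e ∣ a + b`. Here `x = a * b * d`, and `a`, `b` are the coprime parts
of `y / p` and `z / p`. -/
theorem IsTypeIISolution.exists_param {m p x y z : ℕ} (h : IsTypeIISolution m p x y z)
    (hp0 : 0 < p) :
    ∃ a b d e : ℕ, 0 < a ∧ a ≤ b ∧ 0 < d ∧ 0 < e ∧ e ∣ a + b ∧ m * (a * b * d) = p + e := by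
  obtain ⟨⟨hx, hy, hz, heq⟩, ⟨y, rfl⟩, ⟨z, rfl⟩, hpx⟩ := h
  have hy0 : 0 < y := Nat.pos_of_mul_pos_left hy
  have hz0 : 0 < z := Nat.pos_of_mul_pos_left hz
  have key : m * x * (y * z) = p * (y * z) + x * (y + z) := by
    have : (m : ℚ) * x * (y * z) = p * (y * z) + x * (y + z) := by
      push_cast at heq
      field_simp at heq
      linarith
    exact_mod_cast this
  have hlt : p < m * x := by
    have : p * (y * z) < m * x * (y * z) := by
      rw [key]; exact Nat.lt_add_of_pos_right (by positivity)
    exact lt_of_mul_lt_mul_right this (Nat.zero_le _)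
  obtain ⟨e, he0, he⟩ : ∃ e, 0 < e ∧ m * x = p + e := ⟨m * x - p, by omega, by omega⟩
  have hexy : e * (y * z) = x * (y + z) := by
    rw [he] at key; linarith
  obtain ⟨g, a, b, hg, hab, rfl, rfl⟩ := Nat.exists_coprime' (Nat.gcd_pos_of_pos_left z hy0)
  have ha : 0 < a := Nat.pos_of_mul_pos_right hy0
  have hb : 0 < b := Nat.pos_of_mul_pos_right hz0
  have h1 : e * g * (a * b) = x * (a + b) := by
    apply Nat.eq_of_mul_eq_mul_left hg
    linarith
  have hcop : Nat.Coprime (a * b) (a + b) :=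
    Nat.Coprime.mul_left (by simpa using hab) (by simpa using hab.symm)
  obtain ⟨d, rfl⟩ : a * b ∣ x := hcop.dvd_of_dvd_mul_right ⟨e * g, by linarith⟩
  have hd : 0 < d := Nat.pos_of_mul_pos_left hx
  have h2 : e * g = d * (a + b) := by
    apply Nat.eq_of_mul_eq_mul_left (Nat.mul_pos ha hb)
    linarith
  have hde : Nat.Coprime d e := by
    have h3 : Nat.gcd d e ∣ p :=
      (Nat.dvd_add_left (Nat.gcd_dvd_right d e)).mp
        (he ▸ ((Nat.gcd_dvd_left d e).mul_left _).mul_left _)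
    exact Nat.eq_one_of_dvd_coprimes hpx h3 ((Nat.gcd_dvd_left d e).mul_left _)
  obtain ⟨c, rfl⟩ : d ∣ g := hde.dvd_of_dvd_mul_left ⟨a + b, h2⟩
  have h3 : a + b = e * c := by
    apply Nat.eq_of_mul_eq_mul_left hd
    linarith
  rcases le_total a b with hle | hle
  · exact ⟨a, b, d, e, ha, hle, hd, he0, ⟨c, h3⟩, he⟩
  · exact ⟨b, a, d, e, hb, hle, hd, he0, ⟨c, by linarith⟩, by rw [mul_comm b a]; exact he⟩

theorem Nat.add_le_mul_add_one {a b : ℕ} (ha : 0 < a) (hb : 0 < b) : a + b ≤ a * b + 1 := by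
  nlinarith [Nat.mul_le_mul ha hb]

/-! ### A sufficient condition for the absence of Type II solutions -/

/-- If `p = m * n - r` with `n / 2 + 2 < r < m ≤ n`, then a parametrized solution is
forced to have `e = r` and `a * b * d = n`, and no divisor pair of `n` has a sum that is a
multiple of such an `r`. -/
theorem not_isTypeIISolution_of_residue {m n r p : ℕ} (hp : 0 < p) (hpr : m * n = p + r)
    (hr : n + 4 < 2 * r) (hrm : r < m) (hmn : m ≤ n) :
    ¬ ∃ x y z : ℕ, IsTypeIISolution m p x y z := by
  rintro ⟨x, y, z, h⟩
  obtain ⟨a, b, d, e, ha, hab, hd, he, hdvd, hN⟩ := h.exists_param hp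
  have hb : 0 < b := ha.trans_le hab
  have hle : e ≤ a + b := Nat.le_of_dvd (by omega) hdvd
  have hab1 := Nat.add_le_mul_add_one ha hb
  have habd : a * b ≤ a * b * d := Nat.le_mul_of_pos_right _ hd
  -- the difference of the two representations is a multiple of `m`
  have hge : n ≤ a * b * d := by
    by_contra hlt
    have : m * (a * b * d + 1) ≤ m * n := Nat.mul_le_mul_left _ (by omega)
    rw [Nat.mul_add] at this
    omega
  have hnN : a * b * d = n := by
    by_contra hne
    obtain ⟨k, hk⟩ := Nat.exists_eq_add_of_lt (lt_of_le_of_ne hge (Ne.symm hne))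
    rw [hk] at hN
    have h1 : e = r + m * (k + 1) := by
      have : m * (n + k + 1) = m * n + m * (k + 1) := by ring
      omega
    have h2 : m * (k + 1) = m * k + m := by ring
    have h3 : k ≤ m * k := Nat.le_mul_of_pos_left _ (by omega)
    omega
  have her : e = r := by rw [hnN] at hN; omega
  subst her
  rcases Nat.lt_or_ge 1 d with hd2 | hd1
  · have : a * b * 2 ≤ a * b * d := Nat.mul_le_mul_left _ hd2
    omega
  · obtain rfl : d = 1 := by omega
    rcases Nat.lt_or_ge 1 a with ha2 | ha1
    · obtain ⟨a', rfl⟩ := Nat.exists_eq_add_of_le ha2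
      obtain ⟨b', rfl⟩ := Nat.exists_eq_add_of_le (Nat.succ_le_of_lt (ha2.trans_le hab))
      nlinarith [Nat.zero_le (a' * b')]
    · obtain rfl : a = 1 := by omega
      rw [one_mul, mul_one] at hnN
      obtain ⟨q, hq⟩ := hdvd
      have hq1 : q ≠ 0 := by rintro rfl; omega
      have hq2 : q ≠ 1 := by rintro rfl; omega
      have : e * 2 ≤ e * q := Nat.mul_le_mul_left _ (by omega)
      omega

/-- One prime a little below `c ^ 2` serves every `m` with `c - K ≤ m < c`: writing `m = c - k`,
one has `m * (c + k) = c ^ 2 - k ^ 2`, so the residue `r` is `c ^ 2 - p - k ^ 2`. -/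
theorem not_isTypeIISolution_of_near_square {c K m p : ℕ} (hp1 : c ^ 2 < p + c)
    (hp2 : 2 * p + c + 2 * K ^ 2 + K + 4 < 2 * c ^ 2) (hK : 3 * K ≤ c) (hm : c ≤ m + K)
    (hmc : m < c) :
    m ^ 2 < p ∧ p ≤ 2 * m ^ 2 ∧ ¬ ∃ x y z : ℕ, IsTypeIISolution m p x y z := by
  obtain ⟨k, rfl⟩ := Nat.exists_eq_add_of_lt hmc
  have hkK : (k + 1) ^ 2 ≤ K ^ 2 := Nat.pow_le_pow_left (by omega) 2
  have hsq : m * (m + 2 * (k + 1)) + (k + 1) ^ 2 = (m + k + 1) ^ 2 := by ring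
  obtain ⟨r, hr⟩ : ∃ r, m * (m + 2 * (k + 1)) = p + r :=
    ⟨m * (m + 2 * (k + 1)) - p, by omega⟩
  have hmm : m * (m + 2 * (k + 1)) ≤ m * (2 * m) := Nat.mul_le_mul_left _ (by omega)
  have hk1 : k + 1 ≤ (k + 1) ^ 2 := Nat.le_self_pow two_ne_zero _
  have hmk : m ≤ m * (k + 1) := Nat.le_mul_of_pos_right _ (by omega)
  have hrm : r < m := by omega
  have hm2 : m * (m + 2 * (k + 1)) = m ^ 2 + 2 * (m * (k + 1)) := by ring
  have hm3 : m * (2 * m) = 2 * m ^ 2 := by ring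
  have hp0 : 0 < p := by
    have := Nat.zero_le (m ^ 2)
    omega
  exact ⟨by omega, by omega, not_isTypeIISolution_of_residue hp0 hr (by omega) hrm (by omega)⟩

/-! ### Values of `m` below `65536` -/

/-- The product of the `2 ^ k` terms `s, s + 2, s + 4, …`. The binary recursion keeps the
evaluation shallow. -/
def stepTwoProd : ℕ → ℕ → ℕ
  | 0, s => s
  | k + 1, s => stepTwoProd k s * stepTwoProd k (s + 2 * 2 ^ k)

theorem dvd_stepTwoProd (k s i : ℕ) (hi : i < 2 ^ k) : s + 2 * i ∣ stepTwoProd k s := by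
  induction k generalizing s i with
  | zero => obtain rfl : i = 0 := by simpa using hi
            simp [stepTwoProd]
  | succ k ih =>
    rw [stepTwoProd]
    rcases Nat.lt_or_ge i (2 ^ k) with h | h
    · exact (ih s i h).mul_right _
    · obtain ⟨j, rfl⟩ := Nat.exists_eq_add_of_le h
      have := ih (s + 2 * 2 ^ k) j (by rw [pow_succ] at hi; omega)
      rw [show s + 2 * (2 ^ k + j) = s + 2 * 2 ^ k + 2 * j by ring]
      exact this.mul_left _

theorem Nat.Prime.dvd_two_mul_stepTwoProd {q k : ℕ} (hq : q.Prime) (hqk : q ≤ 2 * 2 ^ k) :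
    q ∣ 2 * stepTwoProd k 3 := by
  rcases hq.eq_two_or_odd' with rfl | ⟨i, rfl⟩
  · exact dvd_mul_right _ _
  · have h0 : i ≠ 0 := by rintro rfl; exact Nat.not_prime_one hq
    obtain ⟨j, rfl⟩ := Nat.exists_eq_succ_of_ne_zero h0
    have := dvd_stepTwoProd k 3 j (by omega)
    rw [show 2 * (j + 1) + 1 = 3 + 2 * j by ring]
    exact this.mul_left _

/-- Whether one of the `fuel` numbers `p, p + 2, p + 4, …` is coprime to `P`, the first such being
below `b`. -/
def searchCoprime (P b : ℕ) : ℕ → ℕ → Bool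
  | 0, _ => false
  | fuel + 1, p =>
    bif Nat.beq (Nat.gcd (P % p) p) 1 then Nat.blt p b else searchCoprime P b fuel (p + 2)

theorem exists_of_searchCoprime {P b fuel p : ℕ} (h : searchCoprime P b fuel p = true) :
    ∃ q, p ≤ q ∧ q < b ∧ Nat.Coprime P q := by
  induction fuel generalizing p with
  | zero => simp [searchCoprime] at h
  | succ k ih =>
    rw [searchCoprime] at h
    cases hg : Nat.beq (Nat.gcd (P % p) p) 1 with
    | true =>
      rw [hg, cond_true] at h
      refine ⟨p, le_rfl, Nat.blt_eq.mp h, ?_⟩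
      have := Nat.eq_of_beq_eq_true hg
      rw [← Nat.gcd_rec, Nat.gcd_comm] at this
      exact this
    | false =>
      rw [hg, cond_false] at h
      obtain ⟨q, hq, hqb, hc⟩ := ih h
      exact ⟨q, by omega, hqb, hc⟩

/-- For each of the `2 ^ k` values `c = s + K, s + 2 * K, …`, searches the interval of
`not_isTypeIISolution_of_near_square` for a number coprime to `P`. -/
def searchBlocks (P K : ℕ) : ℕ → ℕ → Bool
  | 0, s => searchCoprime P ((s + K) ^ 2 - ((s + K) + 2 * K ^ 2 + K + 4) / 2) s
      ((s + K) ^ 2 - (s + K) + 1)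
  | k + 1, s => searchBlocks P K k s && searchBlocks P K k (s + K * 2 ^ k)

/-- A successful search settles every `m` in `[s, s + K * 2 ^ k)`. The number `P` has to be divisible
by the primes up to `B`, and the candidates have to exceed `B`, as a prime up to `B` is not coprime
to `P`. -/
theorem exists_prime_of_searchBlocks {P K k s B : ℕ}
    (hP : ∀ q : ℕ, q.Prime → q ≤ B → q ∣ P) (hs : B < (s + K) ^ 2 - (s + K))
    (hB : s + K * 2 ^ k ≤ B) (hK : 2 * K ≤ s) (hK0 : 0 < K)
    (h : searchBlocks P K k s = true) {m : ℕ} (hsm : s ≤ m) (hms : m < s + K * 2 ^ k) :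
    ∃ p : ℕ, p.Prime ∧ m ^ 2 < p ∧ p ≤ 2 * m ^ 2 ∧
      ¬ ∃ x y z : ℕ, IsTypeIISolution m p x y z := by
  induction k generalizing s with
  | zero =>
    rw [searchBlocks] at h
    rw [pow_zero, mul_one] at hB hms
    obtain ⟨p, hp1, hp2, hcop⟩ := exists_of_searchCoprime h
    have hp : p.Prime := by
      by_contra hnp
      -- the least prime factor of a composite `p < c ^ 2` is below `c ≤ B`
      have hp0 : 1 < p := by omega
      have hmf := Nat.minFac_sq_le_self (by omega) hnp
      have hlt : p.minFac < s + K := by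
        refine lt_of_pow_lt_pow_left₀ 2 (Nat.zero_le _) (hmf.trans_lt ?_)
        omega
      have hpr := Nat.minFac_prime hp0.ne'
      exact hpr.one_lt.ne' (Nat.eq_one_of_dvd_coprimes hcop (hP _ hpr (by omega))
        (Nat.minFac_dvd p))
    obtain ⟨h1, h2, h3⟩ := not_isTypeIISolution_of_near_square (c := s + K) (K := K) (m := m)
      (p := p) (by omega) (by omega) (by omega) (by omega) hms
    exact ⟨p, hp, h1, h2, h3⟩
  | succ k ih =>
    rw [searchBlocks, Bool.and_eq_true] at h
    have hpow : K * 2 ^ (k + 1) = K * 2 ^ k + K * 2 ^ k := by ring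
    rcases Nat.lt_or_ge m (s + K * 2 ^ k) with hlt | hge
    · exact ih hs (by omega) hK h.1 hsm hlt
    · refine ih ?_ (by omega) (by omega) h.2 hge (by omega)
      refine hs.trans_le ?_
      have : ∀ u v : ℕ, u ≤ v → u ^ 2 - u ≤ v ^ 2 - v := by
        intro u v huv
        have : ∀ w : ℕ, w ^ 2 - w = w * (w - 1) := fun w => by
          rw [Nat.mul_sub, mul_one, sq]
        rw [this, this]
        exact Nat.mul_le_mul huv (by omega)
      exact this _ _ (by omega)

/-- The step is `1` here, and the product is over small primes only, as a prime candidate must not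
itself divide it. -/
theorem searchBlocks_small : searchBlocks (2 * stepTwoProd 9 3) 1 9 41 = true := by
  decide +kernel

/-- The step `K` is limited by `2 * K ^ 2` being well below `c / 2`, which leaves an interval long
enough to contain a prime; so it grows like the square root of `c`. -/
theorem searchBlocks_large :
    (searchBlocks (2 * stepTwoProd 16 3) 4 9 553 && searchBlocks (2 * stepTwoProd 16 3) 16 10 2601
      && searchBlocks (2 * stepTwoProd 16 3) 64 10 18985) = true := by
  decide +kernel

theorem exists_prime_of_mid {m : ℕ} (h1 : 41 ≤ m) (h2 : m < 65536) :
    ∃ p : ℕ, p.Prime ∧ m ^ 2 < p ∧ p ≤ 2 * m ^ 2 ∧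
      ¬ ∃ x y z : ℕ, IsTypeIISolution m p x y z := by
  have hl := searchBlocks_large
  rw [Bool.and_eq_true, Bool.and_eq_true] at hl
  obtain ⟨⟨hb, hc⟩, hd⟩ := hl
  have hP := fun (k q : ℕ) (hq : q.Prime) (h : q ≤ 2 * 2 ^ k) => hq.dvd_two_mul_stepTwoProd h
  rcases Nat.lt_or_ge m 553 with h | h
  · exact exists_prime_of_searchBlocks (hP 9) (by norm_num) (by norm_num) (by norm_num)
      (by norm_num) searchBlocks_small h1 h
  rcases Nat.lt_or_ge m 2601 with h' | h'
  · exact exists_prime_of_searchBlocks (hP 16) (by norm_num) (by norm_num) (by norm_num)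
      (by norm_num) hb h h'
  rcases Nat.lt_or_ge m 18985 with h'' | h''
  · exact exists_prime_of_searchBlocks (hP 16) (by norm_num) (by norm_num) (by norm_num)
      (by norm_num) hc h' h''
  · exact exists_prime_of_searchBlocks (hP 16) (by norm_num) (by norm_num) (by norm_num)
      (by norm_num) hd h'' (by omega)

/-- A finite test for the absence of Type II solutions: `m * n = p + e` and `e ≤ n + 1` bound `n`
by `(p + 1) / (m - 1)`. -/
theorem not_isTypeIISolution_of_forall {m p : ℕ} (hm : 2 ≤ m) (hp : 0 < p)
    (h : ∀ n ∈ Finset.range ((p + 1) / (m - 1) + 1), p < m * n → ∀ a ∈ n.divisors,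
      ∀ b ∈ n.divisors, a * b ∣ n → ¬ m * n - p ∣ a + b) :
    ¬ ∃ x y z : ℕ, IsTypeIISolution m p x y z := by
  rintro ⟨x, y, z, hs⟩
  obtain ⟨a, b, d, e, ha, hab, hd, he, hdvd, hN⟩ := hs.exists_param hp
  have hb : 0 < b := ha.trans_le hab
  have hle : e ≤ a + b := Nat.le_of_dvd (by omega) hdvd
  have hab1 := Nat.add_le_mul_add_one ha hb
  have habd : a * b ≤ a * b * d := Nat.le_mul_of_pos_right _ hd
  have ha1 : a ≤ a * b := Nat.le_mul_of_pos_right _ hb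
  have hb1 : b ≤ a * b := Nat.le_mul_of_pos_left _ ha
  have hn0 : a * b * d ≠ 0 := by positivity
  refine h (a * b * d) ?_ (by omega) a (Nat.mem_divisors.mpr ⟨⟨b * d, by ring⟩, hn0⟩)
    b (Nat.mem_divisors.mpr ⟨⟨a * d, by ring⟩, hn0⟩) (dvd_mul_right _ _) ?_
  · rw [Finset.mem_range, Nat.lt_add_one_iff, Nat.le_div_iff_mul_le (by omega), Nat.mul_sub,
      mul_one, mul_comm, hN]
    omega
  · rwa [hN, Nat.add_sub_cancel_left]

theorem exists_prime_of_small {m : ℕ} (h1 : 6 ≤ m) (h2 : m < 41) (h7 : m ≠ 7) :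
    ∃ p : ℕ, p.Prime ∧ m ^ 2 < p ∧ p ≤ 2 * m ^ 2 ∧
      ¬ ∃ x y z : ℕ, IsTypeIISolution m p x y z := by
  have key : ∀ m ∈ Finset.range 41, 6 ≤ m → m ≠ 7 → ∃ i ∈ Finset.range (m ^ 2),
      (∀ d ∈ Finset.range 57, d ∣ m ^ 2 + 1 + i → d = 1 ∨ d = m ^ 2 + 1 + i) ∧
      ∀ n ∈ Finset.range ((m ^ 2 + 1 + i + 1) / (m - 1) + 1), m ^ 2 + 1 + i < m * n →
        ∀ a ∈ n.divisors, ∀ b ∈ n.divisors, a * b ∣ n → ¬ m * n - (m ^ 2 + 1 + i) ∣ a + b := by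
    decide +kernel
  obtain ⟨i, hi, hpr, hg⟩ := key m (Finset.mem_range.mpr h2) h1 h7
  rw [Finset.mem_range] at hi
  have hm2 : m ^ 2 ≤ 40 ^ 2 := Nat.pow_le_pow_left (by omega) 2
  refine ⟨m ^ 2 + 1 + i, ?_, by omega, by omega,
    not_isTypeIISolution_of_forall (by omega) (by omega) hg⟩
  -- a composite number up to `2 * 40 ^ 2` has a divisor below `57`
  have h0 : m ^ 2 ≠ 0 := by positivity
  by_contra hnp
  have hmf := Nat.minFac_sq_le_self (by omega) hnp
  have hmp : (m ^ 2 + 1 + i).minFac.Prime := Nat.minFac_prime (by omega)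
  have hlt : (m ^ 2 + 1 + i).minFac < 57 :=
    lt_of_pow_lt_pow_left₀ 2 (Nat.zero_le _) (by omega)
  rcases hpr _ (Finset.mem_range.mpr hlt) (Nat.minFac_dvd _) with h | h
  · exact hmp.one_lt.ne' h
  · exact hnp (h ▸ hmp)

/-- For `m = 7` no prime in `(49, 98]` will do; the smallest prime above `49` without a Type II
solution is `127`. -/
theorem not_isTypeIISolution_seven : ¬ ∃ x y z : ℕ, IsTypeIISolution 7 127 x y z :=
  not_isTypeIISolution_of_forall (by norm_num) (by norm_num) (by decide +kernel)

/-! ### A lower bound for the number of primes in `(n, 2 * n]` -/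

/-- The primes in `(n, 2 * n]` must account for the size of the central binomial coefficient, as
its prime factors up to `2 * n / 3` contribute too little, and those in `(2 * n / 3, n]` do not
occur. -/
theorem Nat.centralBinom_le_pow_card_primes (n : ℕ) (hn : 2 < n) :
    n.centralBinom ≤ (2 * n) ^ (Nat.sqrt (2 * n) + ((Finset.Ioc n (2 * n)).filter Nat.Prime).card) *
      4 ^ (2 * n / 3) := by
  have n2_pos : 1 ≤ 2 * n := by omega
  let f : ℕ → ℕ := fun x => x ^ n.centralBinom.factorization x
  let S₁ := (Finset.Icc 1 (Nat.sqrt (2 * n))).filter Nat.Prime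
  let S₂ := (Finset.Ioc n (2 * n)).filter Nat.Prime
  let S₃ := (Finset.Ioc (Nat.sqrt (2 * n)) (2 * n / 3)).filter Nat.Prime
  have hf1 : ∀ p, f p ≤ 2 * n := fun p => Nat.pow_factorization_choose_le (by omega)
  have hfpos : ∀ p, p.Prime → 1 ≤ f p := fun p hp => Nat.one_le_pow _ _ hp.pos
  have hprod : n.centralBinom ≤ ∏ p ∈ (S₁ ∪ S₂) ∪ S₃, f p := by
    rw [← n.prod_pow_factorization_centralBinom]
    refine le_of_eq (Finset.prod_subset_one_on_sdiff ?_ ?_ fun _ _ => rfl).symm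
    · intro p hp
      simp only [S₁, S₂, S₃, Finset.mem_union, Finset.mem_filter, Finset.mem_Icc,
        Finset.mem_Ioc] at hp
      have := Nat.sqrt_le_self (2 * n)
      rw [Finset.mem_range]
      omega
    · intro p hp
      simp only [S₁, S₂, S₃, Finset.mem_sdiff, Finset.mem_union, Finset.mem_filter,
        Finset.mem_Icc, Finset.mem_Ioc, Finset.mem_range] at hp
      by_cases hpp : p.Prime
      · have h1 := hpp.one_lt
        have : n.centralBinom.factorization p = 0 :=
          Nat.factorization_centralBinom_of_two_mul_self_lt_three_mul hn
            (by simp only [hpp, and_true] at hp; omega) (by simp only [hpp, and_true] at hp; omega)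
        simp [this]
      · simp [Nat.factorization_eq_zero_of_not_prime _ hpp]
  have hunion : ∀ A B : Finset ℕ, (∀ p ∈ A ∪ B, p.Prime) →
      ∏ p ∈ A ∪ B, f p ≤ (∏ p ∈ A, f p) * ∏ p ∈ B, f p := by
    intro A B h
    rw [← Finset.prod_union_inter]
    exact Nat.le_mul_of_pos_right _ (Finset.prod_pos fun p hp =>
      hfpos p (h p (Finset.mem_union_left _ (Finset.mem_inter.mp hp).1)))
  have hpr : ∀ p ∈ (S₁ ∪ S₂) ∪ S₃, p.Prime := by
    intro p hp
    simp only [S₁, S₂, S₃, Finset.mem_union, Finset.mem_filter] at hp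
    tauto
  have hcard : (S₁ ∪ S₂).card ≤ Nat.sqrt (2 * n) + S₂.card := by
    refine (Finset.card_union_le _ _).trans (Nat.add_le_add_right ?_ _)
    exact (Finset.card_filter_le _ _).trans (by simp)
  refine hprod.trans ((hunion _ _ hpr).trans (mul_le_mul' ?_ ?_))
  · refine (Finset.prod_le_pow_card _ _ _ fun p _ => hf1 p).trans ?_
    exact Nat.pow_le_pow_right n2_pos hcard
  · refine le_trans ?_ (primorial_le_four_pow (2 * n / 3))
    calc ∏ p ∈ S₃, f p ≤ ∏ p ∈ S₃, p := by
          refine Finset.prod_le_prod' fun p hp => ?_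
          simp only [S₃, Finset.mem_filter, Finset.mem_Ioc] at hp
          refine (Nat.pow_le_pow_right hp.2.pos ?_).trans (pow_one p).le
          exact Nat.factorization_choose_le_one (Nat.sqrt_lt'.mp hp.1.1)
      _ ≤ primorial (2 * n / 3) := by
          refine Finset.prod_le_prod_of_subset_of_one_le' ?_ fun p hp _ =>
            (Finset.mem_filter.1 hp).2.one_lt.le
          intro p hp
          simp only [S₃, Finset.mem_filter, Finset.mem_Ioc] at hp
          simp only [Finset.mem_filter, Finset.mem_range]
          exact ⟨by omega, hp.2⟩

theorem mul_log_four_div_three_lt (n : ℕ) (hn : 4 ≤ n) :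
    (n : ℝ) * Real.log 4 / 3 <
      (Nat.sqrt (2 * n) + ((Finset.Ioc n (2 * n)).filter Nat.Prime).card + 1 : ℝ) *
        Real.log (2 * n) := by
  set s := Nat.sqrt (2 * n)
  set S := ((Finset.Ioc n (2 * n)).filter Nat.Prime).card
  have hn0 : (0 : ℝ) < n := by exact_mod_cast (by omega : 0 < n)
  have h1 : 4 ^ n < n * ((2 * n) ^ (s + S) * 4 ^ (2 * n / 3)) :=
    (Nat.four_pow_lt_mul_centralBinom n hn).trans_le
      (Nat.mul_le_mul_left _ (Nat.centralBinom_le_pow_card_primes n (by omega)))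
  have h2 : (4 : ℝ) ^ n < n * ((2 * n) ^ (s + S) * 4 ^ (2 * n / 3)) := by exact_mod_cast h1
  have h3 := Real.log_lt_log (by positivity) h2
  rw [Real.log_mul (by positivity) (by positivity), Real.log_mul (by positivity) (by positivity),
    Real.log_pow, Real.log_pow, Real.log_pow] at h3
  have h4 : ((2 * n / 3 : ℕ) : ℝ) ≤ 2 * n / 3 := by
    have := Nat.cast_div_le (α := ℝ) (m := 2 * n) (n := 3)
    push_cast at this
    exact this
  have h5 : Real.log n ≤ Real.log (2 * n) := Real.log_le_log hn0 (by linarith)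
  have h6 : 0 < Real.log 4 := Real.log_pos (by norm_num)
  have h7 := mul_le_mul_of_nonneg_right h4 h6.le
  push_cast at h3
  linarith

/-! ### Counting the numbers with a Type II solution -/

theorem sum_Icc_inv_le_one_add_log (L : ℕ) :
    ∑ a ∈ Finset.Icc 1 L, (a : ℝ)⁻¹ ≤ 1 + Real.log L := by
  have h := harmonic_le_one_add_log L
  rw [harmonic_eq_sum_Icc] at h
  push_cast at h
  exact h

theorem card_Ioc_div_le (A w k : ℕ) (hk : 0 < k) :
    ((Finset.Ioc (A / k) ((A + w) / k)).card : ℝ) ≤ (w + k) / k := by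
  have hk' : (0 : ℝ) < k := by exact_mod_cast hk
  have h1 : (A + w) / k - A / k ≤ w / k + 1 := 
    Nat.sub_le_iff_le_add'.mpr (Nat.add_div_le_div_add_div_add_one A w k)
  rw [Nat.card_Ioc, add_div, div_self hk'.ne']
  calc (((A + w) / k - A / k : ℕ) : ℝ) ≤ ((w / k + 1 : ℕ) : ℝ) := by exact_mod_cast h1
    _ ≤ w / k + 1 := by push_cast; gcongr; exact Nat.cast_div_le

/-- Upper bound for the number of `p` in `(m ^ 2, 2 * m ^ 2]` admitting a Type II solution. Those
with `e ≤ t` are counted by the pairs `(a * b * d, e)`. For the others write `a + b = f * e`: then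
`p` is determined by `(a, d, f, e)`, where `a * d * f ≤ 4 * (t + 1)`, and
`m < a * b * d ≤ 2 * m + 2` confines `a * d * f * e` to an interval of length `m + 2`. -/
theorem card_typeII_le {m t : ℕ} (hm : 6 ≤ m) (ht : m + 1 ≤ (t + 1) ^ 2) (S : Finset ℕ)
    (hS : ∀ p ∈ S, m ^ 2 < p ∧ p ≤ 2 * m ^ 2 ∧ ∃ x y z : ℕ, IsTypeIISolution m p x y z) :
    (S.card : ℝ) ≤ t * (m + 2) +
      (m + 2 + (4 * (t + 1) : ℕ)) * (1 + Real.log (4 * (t + 1) : ℕ)) ^ 3 := by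
  set L := 4 * (t + 1) with hL
  -- `q = (a, d, f)` in `T`, and `n = a * (f * e - a) * d` lies in `(m, 2 * m + 2]` just when
  -- `k q * e` lies in `(lo q, lo q + (m + 2)]`
  let I := Finset.Icc 1 L
  let T := (I ×ˢ (I ×ˢ I)).filter fun q => q.1 * q.2.1 * q.2.2 ≤ L
  let lo : ℕ × ℕ × ℕ → ℕ := fun q => m + q.1 * q.1 * q.2.1
  let k : ℕ × ℕ × ℕ → ℕ := fun q => q.1 * q.2.1 * q.2.2
  let A : Finset ℕ := (Finset.Ioc m (2 * m + 2) ×ˢ Finset.Icc 1 t).image fun q => m * q.1 - q.2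
  let B : Finset ℕ := T.biUnion fun q =>
    (Finset.Ioc (lo q / k q) ((lo q + (m + 2)) / k q)).image fun e =>
      m * (q.1 * (q.2.2 * e - q.1) * q.2.1) - e
  have hsub : S ⊆ A ∪ B := by
    intro p hp
    obtain ⟨hp1, hp2, x, y, z, hs⟩ := hS p hp
    obtain ⟨a, b, d, e, ha, hab, hd, he, hdvd, hN⟩ := hs.exists_param (by omega)
    have hb : 0 < b := ha.trans_le hab
    have hle : e ≤ a + b := Nat.le_of_dvd (by omega) hdvd
    have hab1 := Nat.add_le_mul_add_one ha hb
    have habd : a * b ≤ a * b * d := Nat.le_mul_of_pos_right _ hd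
    have hN1 : m < a * b * d := by
      by_contra hcon
      have : m * (a * b * d) ≤ m * m := Nat.mul_le_mul_left _ (by omega)
      rw [← sq] at this
      omega
    have hN2 : a * b * d ≤ 2 * m + 2 := by
      by_contra hcon
      obtain ⟨j, hj⟩ := Nat.exists_eq_add_of_lt (not_le.mp hcon)
      rw [hj] at hN
      have h1 : m * (2 * m + 2 + j + 1) = 2 * m ^ 2 + 3 * m + m * j := by ring
      have h2 : 1 * j ≤ m * j := Nat.mul_le_mul_right _ (by omega)
      omega
    rw [Finset.mem_union]
    rcases Nat.lt_or_ge t e with hte | hte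
    · right
      obtain ⟨f, hf⟩ := hdvd
      have hf0 : 0 < f := Nat.pos_of_ne_zero (by rintro rfl; omega)
      have hprod : a * d * f * e = a * a * d + a * b * d := by
        have : a * d * f * e = a * d * (e * f) := by ring
        rw [this, ← hf]; ring
      have haad : a * a * d ≤ a * b * d :=
        Nat.mul_le_mul_right _ (Nat.mul_le_mul_left _ hab)
      have hadf : a * d * f ≤ L := by
        have h1 : a * d * f * (t + 1) ≤ a * d * f * e := Nat.mul_le_mul_left _ hte
        have h2 : a * d * f * (t + 1) ≤ L * (t + 1) := by
          rw [hL, mul_assoc 4, ← sq]; omega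
        exact Nat.le_of_mul_le_mul_right h2 (Nat.succ_pos t)
      have hadf0 : 0 < a * d * f := by positivity
      have hmem : ∀ v, 0 < v → v ∣ a * d * f → v ∈ I := fun v hv hdv =>
        Finset.mem_Icc.mpr ⟨hv, (Nat.le_of_dvd hadf0 hdv).trans hadf⟩
      refine Finset.mem_biUnion.mpr ⟨(a, d, f), ?_, Finset.mem_image.mpr ⟨e, ?_, ?_⟩⟩
      · simp only [T, Finset.mem_filter, Finset.mem_product]
        exact ⟨⟨hmem a ha ⟨d * f, by ring⟩, hmem d hd ⟨a * f, by ring⟩,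
          hmem f hf0 ⟨a * d, by ring⟩⟩, hadf⟩
      · simp only [lo, k, Finset.mem_Ioc]
        rw [Nat.div_lt_iff_lt_mul hadf0, Nat.le_div_iff_mul_le hadf0, mul_comm e, hprod]
        omega
      · have : f * e - a = b := by rw [mul_comm, ← hf]; omega
        simp only [this, hN]
        omega
    · left
      exact Finset.mem_image.mpr ⟨(a * b * d, e), by
        simp only [Finset.mem_product, Finset.mem_Ioc, Finset.mem_Icc]; omega, by
        simp only [hN]; omega⟩
  have hA : (A.card : ℝ) ≤ t * (m + 2) := by
    have h1 : A.card ≤ t * (m + 2) := by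
      refine Finset.card_image_le.trans ?_
      rw [Finset.card_product, Nat.card_Ioc, Nat.card_Icc, mul_comm,
        show 2 * m + 2 - m = m + 2 by omega, Nat.add_sub_cancel]
    exact_mod_cast h1
  have hB : (B.card : ℝ) ≤ (m + 2 + L) * (1 + Real.log L) ^ 3 := by
    have h1 : (B.card : ℝ) ≤
        ∑ q ∈ T, ((Finset.Ioc (lo q / k q) ((lo q + (m + 2)) / k q)).card : ℝ) := by
      have : B.card ≤ ∑ q ∈ T, (Finset.Ioc (lo q / k q) ((lo q + (m + 2)) / k q)).card :=
        Finset.card_biUnion_le.trans (Finset.sum_le_sum fun q _ => Finset.card_image_le)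
      exact_mod_cast this
    have h2 : ∀ q ∈ T, ((Finset.Ioc (lo q / k q) ((lo q + (m + 2)) / k q)).card : ℝ) ≤
        (m + 2 + L) * ((q.1 : ℝ)⁻¹ * ((q.2.1 : ℝ)⁻¹ * (q.2.2 : ℝ)⁻¹)) := by
      intro q hq
      simp only [T, I, Finset.mem_filter, Finset.mem_product, Finset.mem_Icc] at hq
      have hk0 : 0 < k q := Nat.mul_pos (Nat.mul_pos hq.1.1.1 hq.1.2.1.1) hq.1.2.2.1
      refine (card_Ioc_div_le _ _ _ hk0).trans ?_
      have h3 : (q.1 : ℝ)⁻¹ * ((q.2.1 : ℝ)⁻¹ * (q.2.2 : ℝ)⁻¹) = (k q : ℝ)⁻¹ := by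
        simp only [k]; push_cast; rw [mul_inv, mul_inv, mul_assoc]
      rw [h3, div_eq_mul_inv]
      have h4 : (k q : ℝ) ≤ L := by exact_mod_cast hq.2
      push_cast
      gcongr
    refine h1.trans ((Finset.sum_le_sum h2).trans ?_)
    rw [← Finset.mul_sum]
    have hsum : ∑ q ∈ T, (q.1 : ℝ)⁻¹ * ((q.2.1 : ℝ)⁻¹ * (q.2.2 : ℝ)⁻¹) ≤
        (1 + Real.log L) ^ 3 := by
      calc ∑ q ∈ T, (q.1 : ℝ)⁻¹ * ((q.2.1 : ℝ)⁻¹ * (q.2.2 : ℝ)⁻¹)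
          ≤ ∑ q ∈ I ×ˢ (I ×ˢ I), (q.1 : ℝ)⁻¹ * ((q.2.1 : ℝ)⁻¹ * (q.2.2 : ℝ)⁻¹) :=
            Finset.sum_le_sum_of_subset_of_nonneg (Finset.filter_subset _ _)
              fun q _ _ => by positivity
        _ = (∑ a ∈ I, (a : ℝ)⁻¹) ^ 3 := by
            simp only [Finset.sum_product, ← Finset.mul_sum, ← Finset.sum_mul]
            ring
        _ ≤ (1 + Real.log L) ^ 3 :=
            pow_le_pow_left₀ (Finset.sum_nonneg fun _ _ => by positivity)
              (sum_Icc_inv_le_one_add_log L) 3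
    gcongr
  calc (S.card : ℝ) ≤ ((A ∪ B).card : ℝ) := by exact_mod_cast Finset.card_le_card hsub
    _ ≤ A.card + B.card := by exact_mod_cast Finset.card_union_le A B
    _ ≤ _ := add_le_add hA hB

/-! ### Values of `m` from `65536` on -/

/-- The tangent to `log` at `4`. -/
theorem log_le_of_four_le {u : ℝ} (hu : 4 ≤ u) : Real.log u ≤ 2 * Real.log 2 + (u / 4 - 1) := by
  have h1 : Real.log u = Real.log 4 + Real.log (u / 4) := by
    rw [← Real.log_mul (by norm_num) (by positivity)]
    congr 1; ring
  have h2 : Real.log 4 = 2 * Real.log 2 := by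
    rw [show (4 : ℝ) = 2 ^ 2 by norm_num, Real.log_pow]; norm_num
  have h3 := Real.log_le_sub_one_of_pos (show 0 < u / 4 by positivity)
  linarith

theorem exists_prime_of_large {m : ℕ} (hm : 65536 ≤ m) :
    ∃ p : ℕ, p.Prime ∧ m ^ 2 < p ∧ p ≤ 2 * m ^ 2 ∧
      ¬ ∃ x y z : ℕ, IsTypeIISolution m p x y z := by
  by_contra! hcon
  set S := (Finset.Ioc (m ^ 2) (2 * m ^ 2)).filter Nat.Prime with hSdef
  set t := Nat.sqrt m with ht
  have hcard := card_typeII_le (m := m) (t := t) (by omega)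
    (by rw [sq]; exact Nat.succ_le_of_lt (Nat.lt_succ_sqrt m)) S (by
      intro p hp
      simp only [hSdef, Finset.mem_filter, Finset.mem_Ioc] at hp
      exact ⟨hp.1.1, hp.1.2, hcon p hp.2 hp.1.1 hp.1.2⟩)
  have hlow := mul_log_four_div_three_lt (m ^ 2) (by nlinarith)
  rw [← hSdef] at hlow
  -- with `u = m ^ (1 / 8) ≥ 4` all bounds become polynomials in `u`
  obtain ⟨u, hu, hmu⟩ : ∃ u : ℝ, 4 ≤ u ∧ (m : ℝ) = u ^ 8 := by
    have hm' : (65536 : ℝ) ≤ m := by exact_mod_cast hm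
    have h8 : ((m : ℝ) ^ ((8 : ℕ) : ℝ)⁻¹) ^ 8 = m :=
      Real.rpow_inv_natCast_pow (Nat.cast_nonneg m) (by norm_num)
    refine ⟨(m : ℝ) ^ ((8 : ℕ) : ℝ)⁻¹, ?_, h8.symm⟩
    refine le_of_pow_le_pow_left₀ (n := 8) (by norm_num) (by positivity) ?_
    rw [h8]
    exact le_of_eq_of_le (by norm_num) hm'
  have hu0 : 0 < u := by linarith
  have hu4 : (256 : ℝ) ≤ u ^ 4 := by
    calc (256 : ℝ) = 4 ^ 4 := by norm_num
      _ ≤ u ^ 4 := by gcongr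
  have hu8 : u ^ 8 = u ^ 4 * u ^ 4 := by ring
  have htu : (t : ℝ) ≤ u ^ 4 := by
    refine le_of_pow_le_pow_left₀ two_ne_zero (by positivity) ?_
    have : ((t ^ 2 : ℕ) : ℝ) ≤ (m : ℝ) := by exact_mod_cast Nat.sqrt_le' m
    push_cast at this
    calc (t : ℝ) ^ 2 ≤ m := this
      _ = (u ^ 4) ^ 2 := by rw [hmu]; ring
  have hlogu := log_le_of_four_le hu
  have hlog2 := Real.log_two_lt_d9
  have hlog2' := Real.log_two_gt_d9
  have hlog4 : Real.log 4 = 2 * Real.log 2 := by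
    rw [show (4 : ℝ) = 2 ^ 2 by norm_num, Real.log_pow]; norm_num
  have hs : (Nat.sqrt (2 * m ^ 2) : ℝ) ≤ 1.5 * u ^ 8 := by
    refine le_of_pow_le_pow_left₀ two_ne_zero (by positivity) ?_
    have : ((Nat.sqrt (2 * m ^ 2) ^ 2 : ℕ) : ℝ) ≤ ((2 * m ^ 2 : ℕ) : ℝ) := by
      exact_mod_cast Nat.sqrt_le' _
    push_cast at this
    rw [← hmu]
    nlinarith [sq_nonneg (m : ℝ)]
  have hlogn : Real.log (2 * (m ^ 2 : ℕ)) ≤ 4 * u + 6.9 := by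
    push_cast
    rw [hmu, Real.log_mul (by norm_num) (by positivity), Real.log_pow, Real.log_pow]
    push_cast
    linarith
  have hlogn0 : 0 ≤ Real.log (2 * (m ^ 2 : ℕ)) := by
    refine Real.log_nonneg ?_
    exact_mod_cast (by nlinarith : 1 ≤ 2 * m ^ 2)
  have hL : ((4 * (t + 1) : ℕ) : ℝ) ≤ 4 * (u ^ 4 + 1) := by push_cast; linarith
  have hlogL : Real.log (4 * (t + 1) : ℕ) ≤ u + 2.94 := by
    have h1 : Real.log (4 * (t + 1) : ℕ) ≤ Real.log (4 * (u ^ 4 * (257 / 256))) :=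
      Real.log_le_log (by positivity) (by linarith)
    rw [Real.log_mul (by norm_num) (by positivity), Real.log_mul (by positivity) (by norm_num),
      Real.log_pow] at h1
    have h2 := Real.log_le_sub_one_of_pos (show (0 : ℝ) < 257 / 256 by norm_num)
    push_cast at h1 ⊢
    linarith
  have hlogL0 : 0 ≤ Real.log (4 * (t + 1) : ℕ) := Real.log_natCast_nonneg _
  have hSu : (S.card : ℝ) ≤ u ^ 8 * (1.001 * u ^ 4 + 1.02 * (u + 3.94) ^ 3) := by
    have h1 : (t : ℝ) * (m + 2) ≤ u ^ 4 * (1.001 * u ^ 8) := by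
      rw [hmu]
      gcongr
      nlinarith
    have h2 : ((m : ℝ) + 2 + (4 * (t + 1) : ℕ)) * (1 + Real.log (4 * (t + 1) : ℕ)) ^ 3 ≤
        (1.02 * u ^ 8) * (u + 3.94) ^ 3 := by
      have h3 : (m : ℝ) + 2 + (4 * (t + 1) : ℕ) ≤ 1.02 * u ^ 8 := by
        rw [hmu]; nlinarith
      have h4 : 1 + Real.log (4 * (t + 1) : ℕ) ≤ u + 3.94 := by linarith
      exact mul_le_mul h3 (pow_le_pow_left₀ (by linarith) h4 3) (by positivity) (by positivity)
    linarith
  have hfin : u ^ 8 * (u ^ 8 * 0.462) <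
      u ^ 8 * ((1.501 + 1.001 * u ^ 4 + 1.02 * (u + 3.94) ^ 3) * (4 * u + 6.9)) := by
    calc u ^ 8 * (u ^ 8 * 0.462) ≤ ((m ^ 2 : ℕ) : ℝ) * Real.log 4 / 3 := by
          push_cast
          rw [hmu, hlog4]
          have : 0 ≤ u ^ 8 * u ^ 8 := by positivity
          nlinarith
      _ < _ := hlow
      _ ≤ (u ^ 8 * (1.501 + 1.001 * u ^ 4 + 1.02 * (u + 3.94) ^ 3)) * (4 * u + 6.9) := by
          refine mul_le_mul ?_ hlogn hlogn0 (by positivity)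
          nlinarith
      _ = _ := by ring
  have hlt := lt_of_mul_lt_mul_left hfin (by positivity)
  -- after the shift `u = 4 + v` all coefficients of the difference are positive
  obtain ⟨v, hv, rfl⟩ : ∃ v : ℝ, 0 ≤ v ∧ u = 4 + v := ⟨u - 4, by linarith, by ring⟩
  have hpos : 0 ≤ (4 + v) ^ 8 * 0.462 -
      (1.501 + 1.001 * (4 + v) ^ 4 + 1.02 * ((4 + v) + 3.94) ^ 3) * (4 * (4 + v) + 6.9) := by
    ring_nf
    positivity
  linarith

theorem mainTheorem6 (m : ℕ) (hm : 6 ≤ m) :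
    (∃ p : ℕ, p.Prime ∧ m ^ 2 < p ∧ ¬ ∃ x y z : ℕ, IsTypeIISolution m p x y z) ∧
    (m ≠ 7 → ∃ p : ℕ, p.Prime ∧ m ^ 2 < p ∧ p ≤ 2 * m ^ 2 ∧
      ¬ ∃ x y z : ℕ, IsTypeIISolution m p x y z) := by
  have key : m ≠ 7 → ∃ p : ℕ, p.Prime ∧ m ^ 2 < p ∧ p ≤ 2 * m ^ 2 ∧
      ¬ ∃ x y z : ℕ, IsTypeIISolution m p x y z := by
    intro h7
    rcases Nat.lt_or_ge m 41 with h1 | h1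
    · exact exists_prime_of_small hm h1 h7
    rcases Nat.lt_or_ge m 65536 with h2 | h2
    · exact exists_prime_of_mid h1 h2
    · exact exists_prime_of_large h2
  refine ⟨?_, key⟩
  rcases eq_or_ne m 7 with rfl | h7
  · exact ⟨127, by norm_num, by norm_num, not_isTypeIISolution_seven⟩
  · obtain ⟨p, hp, h1, -, h2⟩ := key h7
    exact ⟨p, hp, h1, h2⟩
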